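/- The real Cayley–Dickson algebras are $A_0=\mathbb R$ and $A_{n+1}=A_n\times A_n$, with $\overline{(a,b)}=(\overline a,-b)$ (and $\overline a=a$ on $A_0$) and $(a,b)(x,y)=(ax-\overline y\,b,\;ya+b\,\overline x)$. As a vector space $A_n=\mathbb R^{2^n}$; it carries the standard Euclidean inner product and norm $|\cdot|$. An element $a\in A_n$ is pure if $a+\overline a=0$. A zero divisor is an element $a\neq 0$ such that $ax=0$ for some $x\neq 0$. Corollary 4.5. Let $n\ge 3$ and let $\alpha\in A_n$ be a pure element with $|\alpha|=1$. Then there exists $\beta\in A_n$ with $\beta\perp\alpha$ and $|\beta|=1$ such that $(\alpha,\beta)$ is a zero divisor in $A_{n+1}$. Consequently, for every nonzero pure element $\alpha\in A_n$ there is a $\beta\in A_n$ such that $(\alpha,\beta)$ is a zero divisor in $A_{n+1}$. -/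

import Mathlib

/-- The underlying real vector space of the `n`-th real Cayley-Dickson algebra `A_n = ℝ^(2^n)`:
`A_0 = ℝ` and `A_{n+1} = A_n × A_n`. -/
def CD : ℕ → Type
  | 0 => ℝ
  | n + 1 => CD n × CD n

namespace CD

/-- The element `(a, b)` of `A_{n+1} = A_n × A_n`. -/
def pair {n : ℕ} (a b : CD n) : CD (n + 1) := (a, b)

/-- Coordinatewise addition (the additive group structure of `ℝ^(2^n)`). -/
noncomputable instance instAddCommGroup : (n : ℕ) → AddCommGroup (CD n)
  | 0 => inferInstanceAs (AddCommGroup ℝ)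
  | n + 1 =>
    letI := instAddCommGroup n
    inferInstanceAs (AddCommGroup (CD n × CD n))

/-- Coordinatewise real scalar multiplication. -/
noncomputable instance instModule : (n : ℕ) → Module ℝ (CD n)
  | 0 => inferInstanceAs (Module ℝ ℝ)
  | n + 1 =>
    letI := instModule n
    inferInstanceAs (Module ℝ (CD n × CD n))

/-- Conjugation: the identity on `A_0 = ℝ`, and `conj (a, b) = (conj a, -b)`. -/
noncomputable def conj : {n : ℕ} → CD n → CD n
  | 0, a => a
  | _ + 1, (a, b) => pair (conj a) (-b)

/-- Cayley-Dickson multiplication: the multiplication of real numbers on `A_0`, and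
`(a, b) (x, y) = (a x - (conj y) b, y a + b (conj x))`. -/
noncomputable def mul : {n : ℕ} → CD n → CD n → CD n
  | 0, a, x => (show ℝ from a) * (show ℝ from x)
  | _ + 1, (a, b), (x, y) =>
    pair (mul a x - mul (conj y) b) (mul y a + mul b (conj x))

noncomputable instance instMul (n : ℕ) : Mul (CD n) := ⟨mul⟩

/-- The trace `t_n : A_n → ℝ`, `t_n(a) = a + conj a` (twice the real part):
`t_0(a) = 2 a` and `t_{n+1}(a, b) = t_n(a)`. -/
noncomputable def trace : {n : ℕ} → CD n → ℝ
  | 0, a => 2 * (show ℝ from a)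
  | _ + 1, (a, _) => trace a

/-- An element is pure if its trace vanishes. -/
def IsPure {n : ℕ} (a : CD n) : Prop := trace a = 0

/-- The standard Euclidean inner product of `A_n = ℝ^(2^n)`. -/
noncomputable def innerProd : {n : ℕ} → CD n → CD n → ℝ
  | 0, a, x => (show ℝ from a) * (show ℝ from x)
  | _ + 1, (a, b), (x, y) => innerProd a x + innerProd b y

noncomputable instance instInner (n : ℕ) : Inner ℝ (CD n) := ⟨innerProd⟩

/-- The Euclidean norm of `A_n = ℝ^(2^n)`. -/
noncomputable instance instNorm (n : ℕ) : Norm (CD n) := ⟨fun a => √(inner ℝ a a)⟩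

/-- A zero divisor is a nonzero element `a` such that `a x = 0` for some nonzero `x`. -/
def IsZeroDivisor {n : ℕ} (a : CD n) : Prop := a ≠ 0 ∧ ∃ x : CD n, x ≠ 0 ∧ a * x = 0

end CD

namespace CD

section General

variable {n : ℕ}

/-! Seek a zero of the form `(α, β)(x, y) = 0`, with `x`, `y` imaginary units whose left and right
multiplications square to `-1` and are skew. The first coordinate then forces `β = y(αx)`, and the
second vanishes exactly when `y(αx) = -(yα)x`. Skewness makes this `β` orthogonal to `α` and of the
same norm (`IsTwistedPair.exists_mul_eq_zero`). Such `x`, `y` are found among the octonions, where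
dimension 8 leaves room for the needed orthogonality relations (`exists_isTwistedPair_oct`). They
survive every doubling as `(x, 0)`, `(y, 0)` (`IsTwistedPair.pair_zero`), so only the octonion
component of `α` matters. -/

theorem pair_mul_pair (a b x y : CD n) :
    pair a b * pair x y = pair (a * x - conj y * b) (y * a + b * conj x) := rfl

theorem pair_add_pair (a b x y : CD n) : pair a b + pair x y = pair (a + x) (b + y) := rfl

theorem pair_sub_pair (a b x y : CD n) : pair a b - pair x y = pair (a - x) (b - y) := rfl

theorem neg_pair (a b : CD n) : -pair a b = pair (-a) (-b) := rfl

theorem conj_pair (a b : CD n) : conj (pair a b) = pair (conj a) (-b) := rfl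

theorem pair_zero_zero : pair (0 : CD n) 0 = 0 := rfl

theorem inner_pair (a b x y : CD n) :
    inner ℝ (pair a b) (pair x y) = inner ℝ a x + inner ℝ b y := rfl

theorem pair_eq_zero_iff {a b : CD n} : pair a b = 0 ↔ a = 0 ∧ b = 0 := Prod.mk_eq_zero

theorem exists_eq_pair (a : CD (n + 1)) : ∃ b c : CD n, a = pair b c := ⟨a.1, a.2, rfl⟩

end General

theorem conj_zero : (n : ℕ) → conj (0 : CD n) = 0
  | 0 => rfl
  | n + 1 => by rw [← pair_zero_zero, conj_pair, conj_zero n, neg_zero]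

theorem conj_neg : {n : ℕ} → (a : CD n) → conj (-a) = -conj a
  | 0, _ => rfl
  | n + 1, a => by
    obtain ⟨b, c, rfl⟩ := exists_eq_pair a
    rw [neg_pair, conj_pair, conj_pair, neg_pair, conj_neg b]

theorem zero_mul_and_mul_zero : {n : ℕ} → (a : CD n) → 0 * a = 0 ∧ a * 0 = 0
  | 0, a => ⟨MulZeroClass.zero_mul (M₀ := ℝ) a, MulZeroClass.mul_zero (M₀ := ℝ) a⟩
  | n + 1, a => by
    obtain ⟨b, c, rfl⟩ := exists_eq_pair a
    simp [← pair_zero_zero, pair_mul_pair, conj_zero, fun a : CD n => (zero_mul_and_mul_zero a).1,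
      fun a : CD n => (zero_mul_and_mul_zero a).2]

protected theorem zero_mul {n : ℕ} (a : CD n) : 0 * a = 0 := (zero_mul_and_mul_zero a).1

protected theorem mul_zero {n : ℕ} (a : CD n) : a * 0 = 0 := (zero_mul_and_mul_zero a).2

theorem neg_mul_and_mul_neg :
    {n : ℕ} → (a b : CD n) → -a * b = -(a * b) ∧ a * -b = -(a * b)
  | 0, a, b => ⟨_root_.neg_mul (α := ℝ) a b, _root_.mul_neg (α := ℝ) a b⟩
  | n + 1, a, b => by
    obtain ⟨a, a', rfl⟩ := exists_eq_pair a
    obtain ⟨b, b', rfl⟩ := exists_eq_pair b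
    have h₁ := fun a b : CD n => (neg_mul_and_mul_neg a b).1
    have h₂ := fun a b : CD n => (neg_mul_and_mul_neg a b).2
    constructor <;> simp only [neg_pair, pair_mul_pair, conj_neg, h₁, h₂] <;>
      congr 1 <;> abel

protected theorem neg_mul {n : ℕ} (a b : CD n) : -a * b = -(a * b) := (neg_mul_and_mul_neg a b).1

protected theorem mul_neg {n : ℕ} (a b : CD n) : a * -b = -(a * b) := (neg_mul_and_mul_neg a b).2

theorem inner_comm : {n : ℕ} → (a b : CD n) → inner ℝ a b = inner ℝ b a
  | 0, a, b => _root_.mul_comm (G := ℝ) a b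
  | n + 1, a, b => by
    obtain ⟨a, a', rfl⟩ := exists_eq_pair a
    obtain ⟨b, b', rfl⟩ := exists_eq_pair b
    rw [inner_pair, inner_pair, inner_comm a, inner_comm a']

theorem inner_neg_right : {n : ℕ} → (a b : CD n) → inner ℝ a (-b) = -inner ℝ a b
  | 0, a, b => _root_.mul_neg (α := ℝ) a b
  | n + 1, a, b => by
    obtain ⟨a, a', rfl⟩ := exists_eq_pair a
    obtain ⟨b, b', rfl⟩ := exists_eq_pair b
    rw [neg_pair, inner_pair, inner_pair, inner_neg_right a, inner_neg_right a']
    ring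

theorem inner_zero_zero : (n : ℕ) → inner ℝ (0 : CD n) 0 = 0
  | 0 => MulZeroClass.mul_zero (M₀ := ℝ) 0
  | n + 1 => by rw [← pair_zero_zero, inner_pair, inner_zero_zero n, add_zero]

/-- An imaginary element whose left and right multiplications are skew complex structures. -/
structure IsAlternativeUnit {n : ℕ} (x : CD n) : Prop where
  ne_zero : x ≠ 0
  conj_eq : conj x = -x
  mul_mul_self_left (u : CD n) : x * (x * u) = -u
  mul_mul_self_right (u : CD n) : u * x * x = -u
  inner_mul_left (u v : CD n) : inner ℝ (x * u) v = -inner ℝ u (x * v)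
  inner_mul_right (u v : CD n) : inner ℝ (u * x) v = -inner ℝ u (v * x)

/-! ### Passing from `A_n` to `A_{n+1}` -/

section Embedding

variable {n : ℕ} {x : CD n}

theorem pair_zero_mul (u v : CD n) : pair x 0 * pair u v = pair (x * u) (v * x) := by
  rw [pair_mul_pair, CD.mul_zero, CD.zero_mul, sub_zero, add_zero]

theorem mul_pair_zero (hx : conj x = -x) (u v : CD n) :
    pair u v * pair x 0 = pair (u * x) (-(v * x)) := by
  rw [pair_mul_pair, conj_zero, CD.zero_mul, CD.zero_mul, sub_zero, zero_add, hx, CD.mul_neg]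

/-- Left multiplication by `(x, 0)` is left multiplication by `x` on one half and right
multiplication on the other, so the left and right conditions have to be carried together. -/
theorem IsAlternativeUnit.pair_zero (hx : IsAlternativeUnit x) :
    IsAlternativeUnit (pair x 0) where
  ne_zero h := hx.ne_zero (pair_eq_zero_iff.1 h).1
  conj_eq := by rw [conj_pair, hx.conj_eq, neg_pair]
  mul_mul_self_left u := by
    obtain ⟨u, v, rfl⟩ := exists_eq_pair u
    rw [pair_zero_mul, pair_zero_mul, hx.mul_mul_self_left, hx.mul_mul_self_right, neg_pair]
  mul_mul_self_right u := by
    obtain ⟨u, v, rfl⟩ := exists_eq_pair u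
    rw [mul_pair_zero hx.conj_eq, mul_pair_zero hx.conj_eq, CD.neg_mul, hx.mul_mul_self_right,
      hx.mul_mul_self_right, neg_pair, neg_neg]
  inner_mul_left u v := by
    obtain ⟨u, u', rfl⟩ := exists_eq_pair u
    obtain ⟨v, v', rfl⟩ := exists_eq_pair v
    rw [pair_zero_mul, pair_zero_mul, inner_pair, inner_pair, hx.inner_mul_left,
      hx.inner_mul_right]
    ring
  inner_mul_right u v := by
    obtain ⟨u, u', rfl⟩ := exists_eq_pair u
    obtain ⟨v, v', rfl⟩ := exists_eq_pair v
    rw [mul_pair_zero hx.conj_eq, mul_pair_zero hx.conj_eq, inner_pair, inner_pair,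
      hx.inner_mul_right, inner_neg_right, inner_comm (-(u' * x)), inner_neg_right,
      inner_comm v', hx.inner_mul_right]
    ring

end Embedding

/-- A pair of anticommuting alternative units `x`, `y` for which `a` satisfies
`y (a x) = -(y a) x`. -/
structure IsTwistedPair {n : ℕ} (a x y : CD n) : Prop where
  left : IsAlternativeUnit x
  right : IsAlternativeUnit y
  mul_mul_anticomm (u : CD n) : u * x * y = -(u * y * x)
  twist : y * (a * x) = -(y * a * x)

/-- In the twist for `(a, b)`, the first half is the twist for `a`; the second reads `(bx)y =
-(by)x`, which is why anticommutation is required for all `u` and `b` is arbitrary. -/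
theorem IsTwistedPair.pair_zero {n : ℕ} {a x y : CD n} (h : IsTwistedPair a x y) (b : CD n) :
    IsTwistedPair (pair a b) (pair x 0) (pair y 0) where
  left := h.left.pair_zero
  right := h.right.pair_zero
  mul_mul_anticomm u := by
    obtain ⟨u, v, rfl⟩ := exists_eq_pair u
    simp only [mul_pair_zero h.left.conj_eq, mul_pair_zero h.right.conj_eq, CD.neg_mul, neg_neg,
      neg_pair]
    rw [h.mul_mul_anticomm u, h.mul_mul_anticomm v]
  twist := by
    simp only [mul_pair_zero h.left.conj_eq, pair_zero_mul, CD.neg_mul, neg_neg, neg_pair]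
    rw [h.twist, h.mul_mul_anticomm b, neg_neg]

theorem IsTwistedPair.exists_mul_eq_zero {n : ℕ} {a x y : CD n} (h : IsTwistedPair a x y) :
    ∃ b : CD n, inner ℝ a b = 0 ∧ inner ℝ b b = inner ℝ a a ∧
      ∃ z : CD (n + 1), z ≠ 0 ∧ pair a b * z = 0 := by
  refine ⟨y * (a * x), ?_, ?_, pair x y, fun hz => h.left.ne_zero (pair_eq_zero_iff.1 hz).1, ?_⟩
  -- Moving `y` across directly, or `x` across after the twist, gives opposite values, so the inner
  -- product is zero.
  · have h₁ : inner ℝ a (y * (a * x)) = -inner ℝ (y * a) (a * x) := by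
      rw [h.right.inner_mul_left, neg_neg]
    have h₂ : inner ℝ a (y * (a * x)) = inner ℝ (y * a) (a * x) := by
      rw [h.twist, inner_neg_right, inner_comm (y * a), h.left.inner_mul_right]
    linarith
  · rw [h.right.inner_mul_left, h.right.mul_mul_self_left, inner_neg_right, neg_neg,
      h.left.inner_mul_right, h.left.mul_mul_self_right, inner_neg_right, neg_neg]
  · rw [pair_mul_pair, h.left.conj_eq, h.right.conj_eq, CD.neg_mul, h.right.mul_mul_self_left,
      CD.mul_neg, h.twist, CD.neg_mul, h.left.mul_mul_self_right]
    simp [pair_zero_zero]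

/-! ### Octonions in coordinates -/

/-- The element of `A_0` given by a real number. -/
def ofReal (r : ℝ) : CD 0 := r

/-- The octonion with given coordinates. -/
def oct (a : Fin 8 → ℝ) : CD 3 :=
  pair (pair (pair (ofReal (a 0)) (ofReal (a 1))) (pair (ofReal (a 2)) (ofReal (a 3))))
    (pair (pair (ofReal (a 4)) (ofReal (a 5))) (pair (ofReal (a 6)) (ofReal (a 7))))

theorem exists_eq_oct (a : CD 3) : ∃ v, a = oct v :=
  ⟨![a.1.1.1, a.1.1.2, a.1.2.1, a.1.2.2, a.2.1.1, a.2.1.2, a.2.2.1, a.2.2.2], rfl⟩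

theorem ofReal_mul (a b : ℝ) : ofReal a * ofReal b = ofReal (a * b) := rfl
theorem ofReal_add (a b : ℝ) : ofReal a + ofReal b = ofReal (a + b) := rfl
theorem ofReal_sub (a b : ℝ) : ofReal a - ofReal b = ofReal (a - b) := rfl
theorem neg_ofReal (a : ℝ) : -ofReal a = ofReal (-a) := rfl
theorem conj_ofReal (a : ℝ) : conj (ofReal a) = ofReal a := rfl

/-- The multiplication of the octonions in coordinates. -/
def octMul (a b : Fin 8 → ℝ) : Fin 8 → ℝ := ![
  a 0 * b 0 - a 1 * b 1 - a 2 * b 2 - a 3 * b 3 - a 4 * b 4 - a 5 * b 5 - a 6 * b 6 - a 7 * b 7,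
  a 0 * b 1 + a 1 * b 0 + a 2 * b 3 - a 3 * b 2 + a 4 * b 5 - a 5 * b 4 - a 6 * b 7 + a 7 * b 6,
  a 0 * b 2 - a 1 * b 3 + a 2 * b 0 + a 3 * b 1 + a 4 * b 6 + a 5 * b 7 - a 6 * b 4 - a 7 * b 5,
  a 0 * b 3 + a 1 * b 2 - a 2 * b 1 + a 3 * b 0 + a 4 * b 7 - a 5 * b 6 + a 6 * b 5 - a 7 * b 4,
  a 0 * b 4 - a 1 * b 5 - a 2 * b 6 - a 3 * b 7 + a 4 * b 0 + a 5 * b 1 + a 6 * b 2 + a 7 * b 3,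
  a 0 * b 5 + a 1 * b 4 - a 2 * b 7 + a 3 * b 6 - a 4 * b 1 + a 5 * b 0 - a 6 * b 3 + a 7 * b 2,
  a 0 * b 6 + a 1 * b 7 + a 2 * b 4 - a 3 * b 5 - a 4 * b 2 + a 5 * b 3 + a 6 * b 0 - a 7 * b 1,
  a 0 * b 7 - a 1 * b 6 + a 2 * b 5 + a 3 * b 4 - a 4 * b 3 - a 5 * b 2 + a 6 * b 1 + a 7 * b 0]

theorem oct_mul (a b : Fin 8 → ℝ) : oct a * oct b = oct (octMul a b) := by
  simp only [oct, octMul, pair_mul_pair, conj_pair, pair_add_pair, pair_sub_pair, neg_pair, ofReal_mul,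
    ofReal_add, ofReal_sub, neg_ofReal, conj_ofReal, Matrix.cons_val]
  congr 3 <;> congr 1 <;> ring

theorem neg_oct (a : Fin 8 → ℝ) : -oct a = oct (-a) := rfl

theorem inner_oct (a b : Fin 8 → ℝ) : inner ℝ (oct a) (oct b) = a ⬝ᵥ b := by
  have h (r s : ℝ) : inner ℝ (ofReal r) (ofReal s) = r * s := rfl
  simp only [oct, inner_pair, h, dotProduct, Fin.sum_univ_eight]
  ring

theorem trace_oct (a : Fin 8 → ℝ) : trace (oct a) = 2 * a 0 := rfl

theorem octMul_octMul_self_left {x : Fin 8 → ℝ} (hx : x 0 = 0) (u : Fin 8 → ℝ) :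
    octMul x (octMul x u) = -(x ⬝ᵥ x) • u := by
  funext i
  simp only [Pi.smul_apply, smul_eq_mul]
  fin_cases i <;> simp [octMul, dotProduct, Fin.sum_univ_eight, hx] <;> ring

/-- Polarized right alternative law; `y = x` recovers the square, `x ⊥ y` gives anticommutation. -/
theorem octMul_octMul_right {x y : Fin 8 → ℝ} (hx : x 0 = 0) (hy : y 0 = 0) (u : Fin 8 → ℝ) :
    octMul (octMul u x) y = -octMul (octMul u y) x - (2 * (x ⬝ᵥ y)) • u := by
  funext i
  simp only [Pi.sub_apply, Pi.neg_apply, Pi.smul_apply, smul_eq_mul]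
  fin_cases i <;> simp [octMul, dotProduct, Fin.sum_univ_eight, hx, hy] <;> ring

/-- The correction terms list the orthogonality relations that yield the twist. -/
theorem octMul_octMul_twist {a x y : Fin 8 → ℝ} (ha : a 0 = 0) (hx : x 0 = 0) (hy : y 0 = 0) :
    octMul y (octMul a x) = -octMul (octMul y a) x - (2 * (x ⬝ᵥ a)) • y - (2 * (y ⬝ᵥ a)) • x +
      (2 * (x ⬝ᵥ y)) • a + (2 * (octMul x a ⬝ᵥ y)) • Pi.single 0 1 := by
  funext i
  simp only [Pi.add_apply, Pi.sub_apply, Pi.neg_apply, Pi.smul_apply, smul_eq_mul]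
  fin_cases i <;> simp [octMul, dotProduct, Fin.sum_univ_eight, ha, hx, hy] <;> ring

theorem isAlternativeUnit_oct {x : Fin 8 → ℝ} (h₀ : x 0 = 0) (h₁ : x ⬝ᵥ x = 1) :
    IsAlternativeUnit (oct x) where
  ne_zero h := by
    have := inner_oct x x
    rw [h, inner_zero_zero, h₁] at this
    exact zero_ne_one this
  conj_eq := by
    simp [oct, conj_pair, conj_ofReal, neg_pair, neg_ofReal, h₀]
  mul_mul_self_left u := by
    obtain ⟨u, rfl⟩ := exists_eq_oct u
    rw [oct_mul, oct_mul, octMul_octMul_self_left h₀, h₁, neg_one_smul, neg_oct]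
  mul_mul_self_right u := by
    obtain ⟨u, rfl⟩ := exists_eq_oct u
    have h := octMul_octMul_right h₀ h₀ u
    rw [h₁] at h
    rw [oct_mul, oct_mul, neg_oct]
    refine congrArg oct (funext fun i => ?_)
    have := congrFun h i
    simp only [Pi.sub_apply, Pi.neg_apply, Pi.smul_apply, smul_eq_mul] at this ⊢
    linarith
  inner_mul_left u v := by
    obtain ⟨u, rfl⟩ := exists_eq_oct u
    obtain ⟨v, rfl⟩ := exists_eq_oct v
    rw [oct_mul, oct_mul, inner_oct, inner_oct]
    simp only [dotProduct, octMul, Fin.sum_univ_eight, h₀, Matrix.cons_val]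
    ring
  inner_mul_right u v := by
    obtain ⟨u, rfl⟩ := exists_eq_oct u
    obtain ⟨v, rfl⟩ := exists_eq_oct v
    rw [oct_mul, oct_mul, inner_oct, inner_oct]
    simp only [dotProduct, octMul, Fin.sum_univ_eight, h₀, Matrix.cons_val]
    ring

/-- Four linear equations have a normalized common solution in `ℝ⁸`. -/
theorem exists_dotProduct_eq_zero (w : Fin 4 → Fin 8 → ℝ) :
    ∃ v : Fin 8 → ℝ, (∀ i, w i ⬝ᵥ v = 0) ∧ v ⬝ᵥ v = 1 := by
  have h : LinearMap.ker (Matrix.mulVecLin (Matrix.of w)) ≠ ⊥ :=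
    LinearMap.ker_ne_bot_of_finrank_lt (by simp)
  obtain ⟨v, hv, hv₀⟩ := Submodule.exists_mem_ne_zero_of_ne_bot h
  have hpos : 0 < v ⬝ᵥ v := by
    refine lt_of_le_of_ne (Finset.sum_nonneg fun i _ => mul_self_nonneg (v i)) fun h => hv₀ ?_
    exact dotProduct_self_eq_zero.1 h.symm
  refine ⟨(√(v ⬝ᵥ v))⁻¹ • v, fun i => ?_, ?_⟩
  · have : w i ⬝ᵥ v = 0 := congrFun (LinearMap.mem_ker.1 hv) i
    rw [dotProduct_smul, this, smul_zero]
  · have := Real.mul_self_sqrt hpos.le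
    have := (Real.sqrt_pos.2 hpos).ne'
    rw [dotProduct_smul, smul_dotProduct, smul_eq_mul, smul_eq_mul]
    field_simp
    linarith

theorem exists_isTwistedPair_oct {a : Fin 8 → ℝ} (ha : a 0 = 0) :
    ∃ x y, IsTwistedPair (oct a) x y := by
  -- Only two conditions bind `x`; the zeros are padding. The vector `Pi.single 0 1` is the unit
  -- `1`, so orthogonality to it means purity.
  obtain ⟨x, hx, hxx⟩ := exists_dotProduct_eq_zero ![Pi.single 0 1, a, 0, 0]
  obtain ⟨y, hy, hyy⟩ := exists_dotProduct_eq_zero ![Pi.single 0 1, a, x, octMul x a]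
  have hx₀ : x 0 = 0 := by simpa using hx 0
  have hy₀ : y 0 = 0 := by simpa using hy 0
  have hax : x ⬝ᵥ a = 0 := (dotProduct_comm x a).trans (hx 1)
  have hay : y ⬝ᵥ a = 0 := (dotProduct_comm y a).trans (hy 1)
  have hxy : x ⬝ᵥ y = 0 := hy 2
  have hxay : octMul x a ⬝ᵥ y = 0 := hy 3
  refine ⟨oct x, oct y, isAlternativeUnit_oct hx₀ hxx, isAlternativeUnit_oct hy₀ hyy,
    fun u => ?_, ?_⟩
  · obtain ⟨u, rfl⟩ := exists_eq_oct u
    simp only [oct_mul, neg_oct]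
    rw [octMul_octMul_right hx₀ hy₀, hxy, mul_zero, zero_smul, sub_zero]
  · simp only [oct_mul, neg_oct]
    simp [octMul_octMul_twist ha hx₀ hy₀, hax, hay, hxy, hxay]

theorem exists_isTwistedPair {n : ℕ} (hn : 3 ≤ n) :
    ∀ a : CD n, IsPure a → ∃ x y, IsTwistedPair a x y := by
  induction n, hn using Nat.le_induction with
  | base =>
    intro a ha
    obtain ⟨a, rfl⟩ := exists_eq_oct a
    rw [IsPure, trace_oct] at ha
    exact exists_isTwistedPair_oct (by linarith)
  | succ n _ ih =>
    intro a ha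
    obtain ⟨a, b, rfl⟩ := exists_eq_pair a
    -- The trace of a pair is by definition that of its first component, so `ha` applies to it as
    -- is.
    obtain ⟨x, y, h⟩ := ih a ha
    exact ⟨_, _, h.pair_zero b⟩

theorem norm_def {n : ℕ} (a : CD n) : ‖a‖ = √(inner ℝ a a) := rfl

end CD

theorem corollary4p5 (n : ℕ) (hn : 3 ≤ n) :
    (∀ α : CD n, CD.IsPure α → ‖α‖ = 1 →
      ∃ β : CD n, inner ℝ α β = 0 ∧ ‖β‖ = 1 ∧ CD.IsZeroDivisor (CD.pair α β)) ∧
    (∀ α : CD n, CD.IsPure α → α ≠ 0 →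
      ∃ β : CD n, CD.IsZeroDivisor (CD.pair α β)) := by
  constructor
  · intro α hα hnorm
    obtain ⟨x, y, h⟩ := CD.exists_isTwistedPair hn α hα
    obtain ⟨β, horth, hinner, hz⟩ := h.exists_mul_eq_zero
    refine ⟨β, horth, by rw [CD.norm_def, hinner, ← CD.norm_def, hnorm], fun h₀ => ?_, hz⟩
    rw [(CD.pair_eq_zero_iff.1 h₀).1, CD.norm_def, CD.inner_zero_zero, Real.sqrt_zero] at hnorm
    exact zero_ne_one hnorm
  · intro α hα hne
    obtain ⟨x, y, h⟩ := CD.exists_isTwistedPair hn α hα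
    obtain ⟨β, -, -, hz⟩ := h.exists_mul_eq_zero
    exact ⟨β, fun h₀ => hne (CD.pair_eq_zero_iff.1 h₀).1, hz⟩
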